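/- Let $G$ be a three-dimensional Lie group with a bi-invariant Riemannian metric and an orientation of its Lie algebra $\mathfrak g$. Vector fields along a curve in $G$ are written in left-invariant frames, i.e. as $\mathfrak g$-valued functions; $W'$ is the componentwise derivative and $D_TW=W'+\tfrac12[T,W]$ the covariant derivative along a curve with velocity $T$. A positively oriented orthonormal frame $(T,N,B)$ along such a unit-speed curve with $D_TT=\kappa N$ and $\tau=\langle D_TN,B\rangle$ is a Frenet frame with curvature $\kappa$ and torsion $\tau$; put $\tau_G=\tfrac12\langle[T,N],B\rangle$, and call $\tau-\tau_G$ the modified torsion. Let $\alpha:I\to G$ and $\tilde\alpha:\tilde I\to G$ ($I,\tilde I$ open intervals) be smooth curves with arc-length parameters $s,s^*$ and Frenet data $(T,N,B,\kappa,\tau)$ and $(\tilde T,\tilde N,\tilde B,\tilde\kappa,\tilde\tau)$, $\kappa,\tilde\kappa>0$, forming a Bertrand pair: under a smooth bijective correspondence $s\mapsto s^*$ with $ds^*/ds\neq0$ the vectors $N$ and $\tilde N$ are linearly dependent, and $\tilde\alpha=\alpha+\lambda N$ for a function $\lambda\not\equiv0$, where in this equation $\alpha,\tilde\alpha$ stand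 for suitable primitives in $\mathfrak g$ of the left-translated velocities $T,\tilde T$. Assume that $\tilde H=(\tilde\tau-\tilde\tau_G)/\tilde\kappa$ and $\tilde\kappa'$ (derivative in $s^*$) vanish nowhere, and put $\rho=(\tilde\tau-\tilde\tau_G)'/\tilde\kappa'$. Quantities with a tilde and $\rho$ are evaluated at $s^*=s^*(s)$. Then $\rho\ne\tilde H$ everywhere, and there are constants $\epsilon,\sigma\in\{1,-1\}$ with $$N=\epsilon\tilde N,\qquad \frac{ds^*}{ds}=-\sigma\,\frac{\rho-\tilde H}{\tilde H\sqrt{1+\rho^2}} .$$ For every base point $s_0\in I$ the function $$s_b(s)=-\int_{s_0}^{s}\frac{\tilde\kappa(\rho-\tilde H)^2}{\tilde H(1+\rho^2)}\,ds$$ is strictly monotone, and it is a natural parameter of the binormal indicatrix $\alpha_b$ in $\mathfrak g$, $\alpha_b(s_b)=B(s)$: the curve $\alpha_b$ has unit speed with respect to $s_b$, with velocity $T_b=d\alpha_b/ds_b$. With respect to $s_b$ it has the smooth Frenet frame $$T_b=\epsilon\tilde N,\qquad N_b=\frac{-\epsilon}{\sqrt{1+\tilde H^2}}\{\tilde T-\tilde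 H\tilde B\},\qquad B_b=\frac{1}{\sqrt{1+\tilde H^2}}\{\tilde H\tilde T+\tilde B\}$$ with (signed) curvature and modified torsion $$\kappa_b=\sigma\,\frac{\sqrt{(1+\tilde H^2)(1+\rho^2)}}{\rho-\tilde H},\qquad (\tau-\tau_G)_b=\sigma\,\frac{\epsilon\,\tilde\kappa'\sqrt{1+\rho^2}}{\tilde\kappa^2(1+\tilde H^2)} .$$ If moreover $ds^*/ds>0$ and $\tilde H<0$, $\tilde H<\rho$ everywhere, then $\sigma=1$, $s_b$ is strictly increasing and $\kappa_b>0$. -/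

import Mathlib

open Set Bundle
open scoped Manifold ContDiff

noncomputable section

namespace BertrandLie

/-- The model space of a three dimensional Lie group. -/
abbrev V3 : Type := EuclideanSpace ℝ (Fin 3)

/-- The Lie algebra `𝔤 = T_e G` of `G`, with Mathlib's Lie bracket (that of the left-invariant
vector fields). -/
abbrev LieAlg (G : Type*) [TopologicalSpace G] [ChartedSpace V3 G] [Group G] : Type :=
  GroupLieAlgebra 𝓘(ℝ, V3) G

/-- Smooth Riemannian metrics on `G`. -/
abbrev Metric3 (G : Type*) [TopologicalSpace G] [ChartedSpace V3 G] [Group G]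
    [LieGroup 𝓘(ℝ, V3) ∞ G] : Type _ :=
  ContMDiffRiemannianMetric 𝓘(ℝ, V3) ∞ V3 (fun x : G => TangentSpace 𝓘(ℝ, V3) x)

section

variable {G : Type*} [TopologicalSpace G] [ChartedSpace V3 G] [Group G]
  [LieGroup 𝓘(ℝ, V3) ∞ G]

/-- The metric is bi-invariant: all left and all right translations are isometries. -/
structure IsBiInvariant (m : Metric3 G) : Prop where
  left : ∀ (g x : G) (v w : TangentSpace 𝓘(ℝ, V3) x),
    m.inner (g * x) (mfderiv 𝓘(ℝ, V3) 𝓘(ℝ, V3) (fun y : G => g * y) x v)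
      (mfderiv 𝓘(ℝ, V3) 𝓘(ℝ, V3) (fun y : G => g * y) x w) = m.inner x v w
  right : ∀ (g x : G) (v w : TangentSpace 𝓘(ℝ, V3) x),
    m.inner (x * g) (mfderiv 𝓘(ℝ, V3) 𝓘(ℝ, V3) (fun y : G => y * g) x v)
      (mfderiv 𝓘(ℝ, V3) 𝓘(ℝ, V3) (fun y : G => y * g) x w) = m.inner x v w

/-- The scalar product of the metric on `𝔤 = T_e G`. -/
def ip (m : Metric3 G) (v w : LieAlg G) : ℝ := m.inner (1 : G) v w

/-- The torsion `τ_G = ½⟨[T,N],B⟩` of the group along a frame. -/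
def tauG (m : Metric3 G) (T N B : ℝ → LieAlg G) (s : ℝ) : ℝ :=
  (1 / 2) * ip m ⁅T s, N s⁆ (B s)

/-- Covariant derivative of a vector field `W` along a curve with velocity `T`, for the
Levi-Civita connection of a bi-invariant metric, everything being expressed in left-invariant
frames: `D_T W = W' + ½[T,W]`. -/
def covDeriv (T W : ℝ → LieAlg G) (s : ℝ) : LieAlg G :=
  deriv W s + (1 / 2 : ℝ) • ⁅T s, W s⁆

/-- A `𝔤`-valued function is smooth on `S` if its components are. -/
def SmoothComp (S : Set ℝ) (W : ℝ → LieAlg G) : Prop :=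
  ∀ l : LieAlg G →L[ℝ] ℝ, ContDiffOn ℝ ∞ (fun s => l (W s)) S

/-- `T, N, B` is, over `S`, a smooth positively oriented orthonormal frame along a curve with unit
velocity `T`, adapted to the curve, with curvature `κ` and torsion `τ`:
`D_T T = κ N`, `τ = ⟨D_T N, B⟩`. The orientation of `𝔤` is given by the alternating 3-form `vol`
(so that the last condition on the frame is `B = T × N`). Here `κ` may have any sign. -/
structure IsFrenetFrame (m : Metric3 G) (vol : LieAlg G [⋀^Fin 3]→ₗ[ℝ] ℝ) (S : Set ℝ)
    (T N B : ℝ → LieAlg G) (κ τ : ℝ → ℝ) : Prop where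
  smooth_T : SmoothComp S T
  smooth_N : SmoothComp S N
  smooth_B : SmoothComp S B
  unit_T : ∀ s ∈ S, ip m (T s) (T s) = 1
  unit_N : ∀ s ∈ S, ip m (N s) (N s) = 1
  unit_B : ∀ s ∈ S, ip m (B s) (B s) = 1
  orth_TN : ∀ s ∈ S, ip m (T s) (N s) = 0
  orth_TB : ∀ s ∈ S, ip m (T s) (B s) = 0
  orth_NB : ∀ s ∈ S, ip m (N s) (B s) = 0
  oriented : ∀ s ∈ S, 0 < vol ![T s, N s, B s]
  curvature : ∀ s ∈ S, covDeriv T T s = κ s • N s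
  torsion : ∀ s ∈ S, τ s = ip m (covDeriv T N s) (B s)

/-- `(T, N, B, κ, τ)` is the Frenet apparatus of the smooth arc-length parametrized curve `α` in
`G` over `S`, with positive curvature. The velocity `α'(s)` is the value at `α(s)` of the
left-invariant vector field given by `T(s)`. -/
structure IsFrenetApparatus (m : Metric3 G) (vol : LieAlg G [⋀^Fin 3]→ₗ[ℝ] ℝ) (S : Set ℝ)
    (α : ℝ → G) (T N B : ℝ → LieAlg G) (κ τ : ℝ → ℝ) : Prop
    extends IsFrenetFrame m vol S T N B κ τ where
  smooth_curve : ContMDiffOn 𝓘(ℝ, ℝ) 𝓘(ℝ, V3) ∞ α S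
  velocity : ∀ s ∈ S, (mfderiv 𝓘(ℝ, ℝ) 𝓘(ℝ, V3) α s : ℝ →L[ℝ] V3) (1 : ℝ) =
    mulInvariantVectorField (I := 𝓘(ℝ, V3)) (T s) (α s)
  curvature_pos : ∀ s ∈ S, 0 < κ s

/-- `(T, N, B, κ, τ)` is an oriented Frenet apparatus over `J` of the unit speed curve `β` in the
vector space `𝔤`: `β' = T`, and `T, N, B` is a Frenet frame, with a curvature of either sign. -/
structure IsIndicatrixApparatus (m : Metric3 G) (vol : LieAlg G [⋀^Fin 3]→ₗ[ℝ] ℝ) (J : Set ℝ)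
    (β : ℝ → LieAlg G) (T N B : ℝ → LieAlg G) (κ τ : ℝ → ℝ) : Prop
    extends IsFrenetFrame m vol J T N B κ τ where
  velocity : ∀ u ∈ J, HasDerivAt β (T u) u

/-- Bertrand pair: the curve with Frenet vectors `T, N` over `S` and the curve with Frenet vectors
`T', N'` over `S'` correspond to each other under the regular change of parameter `s* = φ s`,
the principal normals are linearly dependent at corresponding points, and `α̃ = α + λN` with `λ`
not identically zero. The sum is read in left-invariant frames, in which `α` and `α̃` stand for
primitives `a`, `a'` of their velocities `T`, `T'`. -/
structure IsBertrandPair (S S' : Set ℝ) (T N T' N' : ℝ → LieAlg G) (φ : ℝ → ℝ) : Prop where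
  smooth : ContDiffOn ℝ ∞ φ S
  bij : BijOn φ S S'
  regular : ∀ s ∈ S, deriv φ s ≠ 0
  normals : ∀ s ∈ S, ∃ r : ℝ, N s = r • N' (φ s)
  mate : ∃ (a a' : ℝ → LieAlg G) (lam : ℝ → ℝ),
    (∀ s ∈ S, HasDerivAt a (T s) s) ∧ (∀ t ∈ S', HasDerivAt a' (T' t) t) ∧
    (∀ s ∈ S, a' (φ s) = a s + lam s • N s) ∧ ∃ s ∈ S, lam s ≠ 0

/-- The modified torsion `τ - τ_G`. -/
def modTorsion (m : Metric3 G) (T N B : ℝ → LieAlg G) (τ : ℝ → ℝ) (s : ℝ) : ℝ :=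
  τ s - tauG m T N B s

/-- The harmonic curvature function `H = (τ - τ_G)/κ`. -/
def harmonicCurvature (m : Metric3 G) (T N B : ℝ → LieAlg G) (κ τ : ℝ → ℝ) (s : ℝ) : ℝ :=
  modTorsion m T N B τ s / κ s

/-- The quotient `ρ = (τ - τ_G)'/κ'`. -/
def rhoFun (m : Metric3 G) (T N B : ℝ → LieAlg G) (κ τ : ℝ → ℝ) (s : ℝ) : ℝ :=
  deriv (modTorsion m T N B τ) s / deriv κ s

end

end BertrandLie

end

/-! The group structure drops out at the start. Since `[T,T] = 0`, the curvature equation reads `T'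
= κN` with the componentwise derivative, and the bracket term in `τ` is exactly `τ_G`, so `μ = τ -
τ_G` equals `⟨N', B⟩`. An orthonormal frame in a three-dimensional space with these two data
satisfies the Euclidean Frenet equations with curvature `κ` and torsion `μ`
(`FrenetSystem.mk_of_orthonormal`). What remains is a statement about curves in a vector space;
below, the mate's quantities carry a tilde.

Parallel normals give `N = εÑ` and make the angle between the tangents constant, so `T = pT̃ + qB̃`
with constants `p² + q² = 1`, and orientation forces `B = ε(pB̃ - qT̃)`. Differentiating the mate
equation shows that `λ` is constant and, with `c = λε`, that `p = (ds*/ds)(1 + cκ̃)` and `q =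
-(ds*/ds)cμ̃`. Eliminating the speed leaves a linear relation `pμ̃ + qκ̃ = -q/c`; its derivative
gives `q = -ρp`. Hence `p²(1 + ρ²) = 1`, and the sign `σ` is that of `p`. The formula for the speed
and `ρ ≠ H̃` follow (`FrenetSystem.bertrand`).

The derivative of `B` is then the integrand of `s_b` times `εÑ`, so `s_b` is a natural parameter of
the indicatrix, whose tangent is `εÑ`. Its curvatures come from `Ñ' = -κ̃(T̃ - H̃B̃)`: the rest of
the frame is a rotation of the rectifying plane by the angle `arctan H̃`
(`FrenetSystem.principalNormal_indicatrix`), and the chain rule supplies the change of parameter. -/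

namespace BertrandLie

/-! ### Orthonormal triples and the Frenet equations in a vector space -/

section Triples

variable {E : Type*} [NormedAddCommGroup E] [NormedSpace ℝ E]

/-- `x, y, z` is an orthonormal triple for the bilinear form `g`. -/
structure OrthonormalTriple (g : E →L[ℝ] E →L[ℝ] ℝ) (x y z : E) : Prop where
  xx : g x x = 1
  yy : g y y = 1
  zz : g z z = 1
  xy : g x y = 0
  yx : g y x = 0
  xz : g x z = 0
  zx : g z x = 0
  yz : g y z = 0
  zy : g z y = 0

/-- Pairing a linear relation with the three vectors isolates its coefficients, so the triple is
independent, and by dimension it spans. Neither symmetry nor positivity of `g` is needed, which is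
why the structure records both orders of each product. -/
theorem OrthonormalTriple.expand {g : E →L[ℝ] E →L[ℝ] ℝ} {x y z : E}
    (h : OrthonormalTriple g x y z) (h3 : Module.finrank ℝ E = 3) (v : E) :
    v = g v x • x + g v y • y + g v z • z := by
  have hli : LinearIndependent ℝ ![x, y, z] := by
    rw [Fintype.linearIndependent_iff]
    intro c hc
    simp only [Fin.sum_univ_three, Matrix.cons_val_zero, Matrix.cons_val_one,
      Matrix.cons_val_two, Matrix.head_cons, Matrix.tail_cons] at hc
    have e (w : E) : c 0 * g x w + c 1 * g y w + c 2 * g z w = 0 := by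
      have := congrArg (fun v => g v w) hc
      simpa using this
    have e0 := e x
    have e1 := e y
    have e2 := e z
    simp only [h.xx, h.yy, h.zz, h.xy, h.yx, h.xz, h.zx, h.yz, h.zy] at e0 e1 e2
    intro i
    fin_cases i
    · simpa using e0
    · simpa using e1
    · simpa using e2
  have hspan := hli.span_eq_top_of_card_eq_finrank (by simp [h3])
  have hv : v ∈ Submodule.span ℝ (range ![x, y, z]) := by rw [hspan]; trivial
  rw [Submodule.mem_span_range_iff_exists_fun] at hv
  obtain ⟨c, hc⟩ := hv
  simp only [Fin.sum_univ_three, Matrix.cons_val_zero, Matrix.cons_val_one,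
    Matrix.cons_val_two, Matrix.head_cons, Matrix.tail_cons] at hc
  have e (w : E) : g v w = c 0 * g x w + c 1 * g y w + c 2 * g z w := by
    rw [← hc]; simp
  rw [e x, e y, e z]
  simp only [h.xx, h.yy, h.zz, h.xy, h.yx, h.xz, h.zx, h.yz, h.zy]
  simpa using hc.symm

/-- The factor is the determinant of a transformation that acts on the plane of `x, z` and scales
`y`. This is how orientation enters all later sign choices. -/
theorem alternating_eval_combination (vol : E [⋀^Fin 3]→ₗ[ℝ] ℝ) (x y z : E) (p q r s e : ℝ) :
    vol ![p • x + q • z, e • y, r • x + s • z] = e * (p * s - q * r) * vol ![x, y, z] := by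
  have add0 (a b c d : E) : vol ![a + b, c, d] = vol ![a, c, d] + vol ![b, c, d] :=
    vol.toMultilinearMap.cons_add ![c, d] a b
  have smul0 (k : ℝ) (a c d : E) : vol ![k • a, c, d] = k * vol ![a, c, d] :=
    vol.toMultilinearMap.cons_smul ![c, d] k a
  have swap01 (a b c : E) : vol ![a, b, c] = -vol ![b, a, c] := by
    have := vol.map_swap ![b, a, c] (show (0 : Fin 3) ≠ 1 by decide)
    rw [← this]; congr 1; ext i; fin_cases i <;> simp [Equiv.swap_apply_def]
  have swap02 (a b c : E) : vol ![a, b, c] = -vol ![c, b, a] := by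
    have := vol.map_swap ![c, b, a] (show (0 : Fin 3) ≠ 2 by decide)
    rw [← this]; congr 1; ext i; fin_cases i <;> simp [Equiv.swap_apply_def]
  have add2 (a b c d : E) : vol ![a, b, c + d] = vol ![a, b, c] + vol ![a, b, d] := by
    rw [swap02, add0, swap02 c, swap02 d]; ring
  have smul2 (k : ℝ) (a b c : E) : vol ![a, b, k • c] = k * vol ![a, b, c] := by
    rw [swap02, smul0, swap02 c]; ring
  have smul1 (k : ℝ) (a b c : E) : vol ![a, k • b, c] = k * vol ![a, b, c] := by
    rw [swap01, smul0, swap01 b]; ring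
  have self02 (a b : E) : vol ![a, b, a] = 0 := by linarith [swap02 a b a]
  simp only [add0, smul0, add2, smul2, smul1, self02, swap02 z y x]
  ring

theorem hasDerivAt_bilin (g : E →L[ℝ] E →L[ℝ] ℝ) {u v : ℝ → E} {u' v' : E} {x : ℝ}
    (hu : HasDerivAt u u' x) (hv : HasDerivAt v v' x) :
    HasDerivAt (fun t => g (u t) (v t)) (g (u x) v' + g u' (v x)) x :=
  ContinuousLinearMap.hasDerivAt_of_bilinear (fun _ => hu) (fun _ => hv)

theorem hasDerivAt_eq_zero_of_eqOn {F : Type*} [NormedAddCommGroup F] [NormedSpace ℝ F]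
    {f : ℝ → F} {f' c : F} {S : Set ℝ} {s : ℝ} (h : HasDerivAt f f' s) (hS : IsOpen S)
    (hs : s ∈ S) (hc : ∀ t ∈ S, f t = c) : f' = 0 :=
  h.unique ((hasDerivAt_const s c).congr_of_eventuallyEq
    (Filter.eventually_of_mem (hS.mem_nhds hs) hc))

theorem hasDerivAt_of_smoothOn {F : Type*} [NormedAddCommGroup F] [NormedSpace ℝ F]
    {f : ℝ → F} {S : Set ℝ} (h : ContDiffOn ℝ ∞ f S) (hS : IsOpen S) {s : ℝ} (hs : s ∈ S) :
    HasDerivAt f (deriv f s) s :=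
  ((h.contDiffAt (hS.mem_nhds hs)).differentiableAt (by simp)).hasDerivAt

theorem smoothOn_deriv {F : Type*} [NormedAddCommGroup F] [NormedSpace ℝ F]
    {f : ℝ → F} {S : Set ℝ} (h : ContDiffOn ℝ ∞ f S) (hS : IsOpen S) :
    ContDiffOn ℝ ∞ (deriv f) S :=
  h.deriv_of_isOpen hS (by simp)

/-- A smooth positively oriented orthonormal frame `T, N, B` satisfying the Frenet equations of
a vector space with curvature `κ` and torsion `μ`. -/
structure FrenetSystem (g : E →L[ℝ] E →L[ℝ] ℝ) (vol : E [⋀^Fin 3]→ₗ[ℝ] ℝ) (S : Set ℝ)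
    (T N B : ℝ → E) (κ μ : ℝ → ℝ) : Prop where
  smooth_T : ContDiffOn ℝ ∞ T S
  smooth_N : ContDiffOn ℝ ∞ N S
  smooth_B : ContDiffOn ℝ ∞ B S
  smooth_κ : ContDiffOn ℝ ∞ κ S
  smooth_μ : ContDiffOn ℝ ∞ μ S
  triple : ∀ s ∈ S, OrthonormalTriple g (T s) (N s) (B s)
  oriented : ∀ s ∈ S, 0 < vol ![T s, N s, B s]
  deriv_T : ∀ s ∈ S, HasDerivAt T (κ s • N s) s
  deriv_N : ∀ s ∈ S, HasDerivAt N (-κ s • T s + μ s • B s) s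
  deriv_B : ∀ s ∈ S, HasDerivAt B (-μ s • N s) s

/-- The equations `T' = κN` and `μ = ⟨N', B⟩` along an orthonormal frame imply all of the Frenet
equations. -/
theorem FrenetSystem.mk_of_orthonormal {g : E →L[ℝ] E →L[ℝ] ℝ} {vol : E [⋀^Fin 3]→ₗ[ℝ] ℝ}
    {S : Set ℝ} {T N B : ℝ → E} {κ μ : ℝ → ℝ} (hS : IsOpen S)
    (h3 : Module.finrank ℝ E = 3) (hg : ∀ v w, g v w = g w v)
    (hT : ContDiffOn ℝ ∞ T S) (hN : ContDiffOn ℝ ∞ N S) (hB : ContDiffOn ℝ ∞ B S)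
    (htr : ∀ s ∈ S, OrthonormalTriple g (T s) (N s) (B s))
    (hor : ∀ s ∈ S, 0 < vol ![T s, N s, B s])
    (hκ : ∀ s ∈ S, deriv T s = κ s • N s) (hμ : ∀ s ∈ S, μ s = g (deriv N s) (B s)) :
    FrenetSystem g vol S T N B κ μ := by
  have dT (s : ℝ) (hs : s ∈ S) : HasDerivAt T (κ s • N s) s := by
    rw [← hκ s hs]; exact hasDerivAt_of_smoothOn hT hS hs
  have dN (s : ℝ) (hs : s ∈ S) := hasDerivAt_of_smoothOn hN hS hs
  have dB (s : ℝ) (hs : s ∈ S) := hasDerivAt_of_smoothOn hB hS hs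
  have smooth_g {U V : ℝ → E} (hU : ContDiffOn ℝ ∞ U S) (hV : ContDiffOn ℝ ∞ V S) :
      ContDiffOn ℝ ∞ (fun s => g (U s) (V s)) S :=
    (g.contDiff.comp_contDiffOn hU).clm_apply hV
  refine ⟨hT, hN, hB, ?_, ?_, htr, hor, dT, ?_, ?_⟩
  · refine (smooth_g (smoothOn_deriv hT hS) hN).congr fun s hs => ?_
    simp [hκ s hs, (htr s hs).yy]
  · exact (smooth_g (smoothOn_deriv hN hS) hB).congr hμ
  · intro s hs
    have h := htr s hs
    -- Differentiating the constant products of the frame gives the components of `N'` along `T` and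
    -- `N`; the one along `B` is `μ` by hypothesis.
    have e1 := hasDerivAt_eq_zero_of_eqOn (hasDerivAt_bilin g (dN s hs) (dT s hs)) hS hs
      fun t ht => (htr t ht).yx
    have e2 := hasDerivAt_eq_zero_of_eqOn (hasDerivAt_bilin g (dN s hs) (dN s hs)) hS hs
      (c := 1) fun t ht => (htr t ht).yy
    simp only [map_smul, smul_eq_mul, h.yy, mul_one] at e1
    rw [hg (N s)] at e2
    have : deriv N s = -κ s • T s + μ s • B s := by
      rw [h.expand h3 (deriv N s), ← hμ s hs, show g (deriv N s) (T s) = -κ s by linarith,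
        show g (deriv N s) (N s) = 0 by linarith]
      simp
    rw [← this]; exact dN s hs
  · intro s hs
    have h := htr s hs
    have e1 := hasDerivAt_eq_zero_of_eqOn (hasDerivAt_bilin g (dB s hs) (dT s hs)) hS hs
      fun t ht => (htr t ht).zx
    have e2 := hasDerivAt_eq_zero_of_eqOn (hasDerivAt_bilin g (dB s hs) (dB s hs)) hS hs
      (c := 1) fun t ht => (htr t ht).zz
    have e3 := hasDerivAt_eq_zero_of_eqOn (hasDerivAt_bilin g (dB s hs) (dN s hs)) hS hs
      fun t ht => (htr t ht).zy
    simp only [map_smul, smul_eq_mul, h.zy, mul_zero, zero_add] at e1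
    rw [hg (B s)] at e2 e3
    rw [← hμ s hs] at e3
    have : deriv B s = -μ s • N s := by
      rw [h.expand h3 (deriv B s), e1, show g (deriv B s) (N s) = -μ s by linarith,
        show g (deriv B s) (B s) = 0 by linarith]
      simp
    rw [← this]; exact dB s hs

end Triples

/-! ### Bertrand mates in a vector space -/

section Bertrand

variable {E : Type*} [NormedAddCommGroup E] [NormedSpace ℝ E]

/-- Both normals have length one, so the factor squares to 1. It equals the continuous function `⟨N,
N' ∘ φ⟩`, hence is constant on a connected set. -/
theorem exists_sign_of_normals_dependent {g : E →L[ℝ] E →L[ℝ] ℝ} {vol : E [⋀^Fin 3]→ₗ[ℝ] ℝ}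
    {S S' : Set ℝ} {T N B T' N' B' : ℝ → E} {κ μ κ' μ' φ : ℝ → ℝ} (hSc : IsPreconnected S)
    (hF : FrenetSystem g vol S T N B κ μ) (hF' : FrenetSystem g vol S' T' N' B' κ' μ')
    (hφ : ContDiffOn ℝ ∞ φ S) (hmap : MapsTo φ S S')
    (hnorm : ∀ s ∈ S, ∃ r : ℝ, N s = r • N' (φ s)) :
    ∃ ε : ℝ, (ε = 1 ∨ ε = -1) ∧ ∀ s ∈ S, N s = ε • N' (φ s) := by
  have hr (s : ℝ) (hs : s ∈ S) : N s = g (N s) (N' (φ s)) • N' (φ s) ∧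
      g (N s) (N' (φ s)) ^ 2 = 1 := by
    obtain ⟨r, hr⟩ := hnorm s hs
    have h1 := (hF'.triple (φ s) (hmap hs)).yy
    have h2 := (hF.triple s hs).yy
    have h3 : g (N s) (N' (φ s)) = r := by simp [hr, h1]
    rw [h3]
    refine ⟨hr, ?_⟩
    simp only [hr, map_smul, smul_apply, h1, smul_eq_mul] at h2
    linarith
  have hcont : ContinuousOn (fun s => g (N s) (N' (φ s))) S :=
    (g.continuous.comp_continuousOn hF.smooth_N.continuousOn).clm_apply
      (hF'.smooth_N.continuousOn.comp hφ.continuousOn hmap)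
  rcases hSc.eq_or_eq_neg_of_sq_eq (g := fun _ => (1 : ℝ)) hcont continuousOn_const
    (fun s hs => by simpa using (hr s hs).2) (fun _ => one_ne_zero) with h | h
  · refine ⟨1, Or.inl rfl, fun s hs => ?_⟩
    have := (hr s hs).1
    rwa [show g (N s) (N' (φ s)) = 1 from h hs] at this
  · refine ⟨-1, Or.inr rfl, fun s hs => ?_⟩
    have := (hr s hs).1
    rwa [show g (N s) (N' (φ s)) = -1 from h hs] at this

/-- The tangents of two curves with parallel principal normals make a constant angle, measured in
the rectifying plane. -/
theorem exists_tangent_eq_combination {g : E →L[ℝ] E →L[ℝ] ℝ} {vol : E [⋀^Fin 3]→ₗ[ℝ] ℝ}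
    {S S' : Set ℝ} {T N B T' N' B' : ℝ → E} {κ μ κ' μ' φ : ℝ → ℝ} {ε : ℝ}
    (h3 : Module.finrank ℝ E = 3) (hS : IsOpen S) (hSc : IsPreconnected S)
    (hF : FrenetSystem g vol S T N B κ μ) (hF' : FrenetSystem g vol S' T' N' B' κ' μ')
    (hφ : ContDiffOn ℝ ∞ φ S) (hmap : MapsTo φ S S') (hε : ε = 1 ∨ ε = -1)
    (hN : ∀ s ∈ S, N s = ε • N' (φ s)) :
    ∃ p q : ℝ, ∀ s ∈ S, T s = p • T' (φ s) + q • B' (φ s) := by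
  have dφ (s : ℝ) (hs : s ∈ S) := hasDerivAt_of_smoothOn hφ hS hs
  have hN' (s : ℝ) (hs : s ∈ S) : N' (φ s) = ε • N s := by
    rw [hN s hs, smul_smul]; rcases hε with rfl | rfl <;> simp
  -- All derivatives involved are multiples of the common normal direction, to which `T`, `T'` and
  -- `B'` are orthogonal.
  have dp (s : ℝ) (hs : s ∈ S) : HasDerivAt (fun s => g (T s) (T' (φ s))) 0 s := by
    have h1 : HasDerivAt (fun s => T' (φ s)) (deriv φ s • κ' (φ s) • N' (φ s)) s :=
      (hF'.deriv_T _ (hmap hs)).scomp s (dφ s hs)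
    refine (hasDerivAt_bilin g (hF.deriv_T s hs) h1).congr_deriv ?_
    have e1 : g (T s) (N' (φ s)) = 0 := by rw [hN' s hs]; simp [(hF.triple s hs).xy]
    simp [e1, hN s hs, (hF'.triple _ (hmap hs)).yx]
  have dq (s : ℝ) (hs : s ∈ S) : HasDerivAt (fun s => g (T s) (B' (φ s))) 0 s := by
    have h1 : HasDerivAt (fun s => B' (φ s)) (deriv φ s • -μ' (φ s) • N' (φ s)) s :=
      (hF'.deriv_B _ (hmap hs)).scomp s (dφ s hs)
    refine (hasDerivAt_bilin g (hF.deriv_T s hs) h1).congr_deriv ?_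
    have e1 : g (T s) (N' (φ s)) = 0 := by rw [hN' s hs]; simp [(hF.triple s hs).xy]
    simp [e1, hN s hs, (hF'.triple _ (hmap hs)).yz]
  obtain ⟨p, hp⟩ := hS.exists_is_const_of_deriv_eq_zero hSc
    (fun s hs => (dp s hs).differentiableAt.differentiableWithinAt) (fun s hs => (dp s hs).deriv)
  obtain ⟨q, hq⟩ := hS.exists_is_const_of_deriv_eq_zero hSc
    (fun s hs => (dq s hs).differentiableAt.differentiableWithinAt) (fun s hs => (dq s hs).deriv)
  refine ⟨p, q, fun s hs => ?_⟩
  have e1 : g (T s) (N' (φ s)) = 0 := by rw [hN' s hs]; simp [(hF.triple s hs).xy]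
  have := (hF'.triple _ (hmap hs)).expand h3 (T s)
  rw [e1, hp s hs, hq s hs] at this
  simpa using this

/-- If `x, e n, b` and `x', n, b'` are positively oriented orthonormal triples, then `b` is the
image of `b'` under the rotation that takes `x'` to `x`, up to the sign `e`. -/
theorem binormal_eq_combination {g : E →L[ℝ] E →L[ℝ] ℝ} {vol : E [⋀^Fin 3]→ₗ[ℝ] ℝ}
    {x b x' n b' : E} {e p q : ℝ} (h3 : Module.finrank ℝ E = 3) (he : e = 1 ∨ e = -1)
    (h : OrthonormalTriple g x (e • n) b) (h' : OrthonormalTriple g x' n b')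
    (ho : 0 < vol ![x, e • n, b]) (ho' : 0 < vol ![x', n, b']) (hx : x = p • x' + q • b') :
    p ^ 2 + q ^ 2 = 1 ∧ b = e • (p • b' - q • x') := by
  have hpq : p ^ 2 + q ^ 2 = 1 := by
    have := h.xx
    simp only [hx, map_add, map_smul, add_apply,
      smul_apply, smul_eq_mul, h'.xx, h'.xz, h'.zx, h'.zz] at this
    linarith
  refine ⟨hpq, ?_⟩
  have hbn : g b n = 0 := by
    have := h.zy
    rw [map_smul, smul_eq_mul] at this
    rcases he with rfl | rfl <;> linarith
  have hb := h'.expand h3 b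
  rw [hbn, zero_smul, add_zero] at hb
  set r := g b x'
  set s := g b b'
  have h1 : p * r + q * s = 0 := by
    have := h.zx
    rwa [hx, map_add, map_smul, map_smul, smul_eq_mul, smul_eq_mul] at this
  have h2 : r ^ 2 + s ^ 2 = 1 := by
    have := h.zz
    rw [hb] at this
    simp only [map_add, map_smul, add_apply,
      smul_apply, smul_eq_mul, h'.xx, h'.xz, h'.zx, h'.zz] at this
    linarith
  rw [hx, hb, alternating_eval_combination] at ho
  have h4 : 0 < e * (p * s - q * r) := pos_of_mul_pos_left ho ho'.le
  -- Lagrange's identity: `(r, s)` is a unit vector orthogonal to the unit vector `(p, q)`, so the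
  -- determinant is `±1`. Positivity of `vol` then selects the sign.
  have h5 : (p * s - q * r) ^ 2 = 1 := by
    linear_combination (r ^ 2 + s ^ 2) * hpq + h2 - (p * r + q * s) * h1
  have he2 : e ^ 2 = 1 := by rcases he with rfl | rfl <;> norm_num
  have h6 : e * (p * s - q * r) = 1 := by
    have : (e * (p * s - q * r)) ^ 2 = 1 := by rw [mul_pow, he2, h5]; norm_num
    nlinarith
  have h7 : p * s - q * r = e := by linear_combination e * h6 - (p * s - q * r) * he2
  have hr : r = -(e * q) := by linear_combination p * h1 - q * h7 - r * hpq
  have hs : s = e * p := by linear_combination q * h1 + p * h7 - s * hpq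
  rw [hb, hr, hs, smul_sub, smul_smul, smul_smul, neg_smul]
  abel

/-- Along a Bertrand mate `a' ∘ φ = a + λN`, the function `λ` is a constant, and the coordinates of
`T` in the frame of the mate are given by the speed of `φ` and by the curvatures of the mate. -/
theorem exists_mate_distance {g : E →L[ℝ] E →L[ℝ] ℝ} {vol : E [⋀^Fin 3]→ₗ[ℝ] ℝ}
    {S S' : Set ℝ} {T N B T' N' B' a a' : ℝ → E} {κ μ κ' μ' φ lam : ℝ → ℝ} {ε p q : ℝ}
    (hS : IsOpen S) (hSc : IsPreconnected S)
    (hF : FrenetSystem g vol S T N B κ μ) (hF' : FrenetSystem g vol S' T' N' B' κ' μ')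
    (hφ : ContDiffOn ℝ ∞ φ S) (hmap : MapsTo φ S S') (hε : ε = 1 ∨ ε = -1)
    (hN : ∀ s ∈ S, N s = ε • N' (φ s)) (hT : ∀ s ∈ S, T s = p • T' (φ s) + q • B' (φ s))
    (ha : ∀ s ∈ S, HasDerivAt a (T s) s) (ha' : ∀ t ∈ S', HasDerivAt a' (T' t) t)
    (hmate : ∀ s ∈ S, a' (φ s) = a s + lam s • N s) (hlam : ∃ s ∈ S, lam s ≠ 0) :
    ∃ c : ℝ, c ≠ 0 ∧ ∀ s ∈ S, p = deriv φ s * (1 + c * κ' (φ s)) ∧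
      q = -(deriv φ s * (c * μ' (φ s))) := by
  have dφ (s : ℝ) (hs : s ∈ S) := hasDerivAt_of_smoothOn hφ hS hs
  have da' (s : ℝ) (hs : s ∈ S) : HasDerivAt (fun s => a' (φ s)) (deriv φ s • T' (φ s)) s :=
    (ha' _ (hmap hs)).scomp s (dφ s hs)
  have dN' (s : ℝ) (hs : s ∈ S) : HasDerivAt (fun s => N' (φ s))
      (deriv φ s • (-κ' (φ s) • T' (φ s) + μ' (φ s) • B' (φ s))) s :=
    (hF'.deriv_N _ (hmap hs)).scomp s (dφ s hs)
  -- No regularity of `lam` is assumed; expressing it through differentiable data supplies it.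
  have hlam_eq (s : ℝ) (hs : s ∈ S) : lam s = g (a' (φ s) - a s) (N s) := by
    simp [hmate s hs, (hF.triple s hs).yy]
  have dlam (s : ℝ) (hs : s ∈ S) : HasDerivAt lam (deriv lam s) s :=
    ((hasDerivAt_bilin g ((da' s hs).sub (ha s hs)) (hF.deriv_N s hs)).congr_of_eventuallyEq
      (Filter.eventually_of_mem (hS.mem_nhds hs) hlam_eq)).differentiableAt.hasDerivAt
  have key (s : ℝ) (hs : s ∈ S) : deriv φ s • T' (φ s) - (p • T' (φ s) + q • B' (φ s)) -
      ((lam s * ε) • (deriv φ s • (-κ' (φ s) • T' (φ s) + μ' (φ s) • B' (φ s))) +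
        (deriv lam s * ε) • N' (φ s)) = 0 := by
    rw [← hT s hs]
    refine hasDerivAt_eq_zero_of_eqOn (((da' s hs).sub (ha s hs)).sub
      (((dlam s hs).mul_const ε).smul (dN' s hs))) hS hs (c := 0)
        fun t ht => ?_
    simp only [Pi.sub_apply, Pi.smul_apply', hmate t ht, hN t ht, smul_smul]
    abel
  -- The normal component of the differentiated mate equation; the components along `T'` and `B'`
  -- later give the two formulas.
  have hdlam (s : ℝ) (hs : s ∈ S) : deriv lam s = 0 := by
    have h' := hF'.triple _ (hmap hs)
    have := congrArg (fun v => g v (N' (φ s))) (key s hs)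
    simp only [map_sub, map_add, map_smul, add_apply,
      sub_apply, smul_apply, smul_eq_mul, h'.xy, h'.yy,
      h'.zy, map_zero, zero_apply] at this
    rcases hε with rfl | rfl <;> linarith
  obtain ⟨l, hl⟩ := hS.exists_is_const_of_deriv_eq_zero hSc
    (fun s hs => (dlam s hs).differentiableAt.differentiableWithinAt) hdlam
  refine ⟨l * ε, ?_, fun s hs => ?_⟩
  · obtain ⟨s, hs, h⟩ := hlam
    rw [hl s hs] at h
    rcases hε with rfl | rfl <;> simpa using h
  · have h' := hF'.triple _ (hmap hs)
    have k1 := congrArg (fun v => g v (T' (φ s))) (key s hs)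
    have k2 := congrArg (fun v => g v (B' (φ s))) (key s hs)
    simp only [map_sub, map_add, map_smul, add_apply,
      sub_apply, smul_apply, smul_eq_mul, h'.xx, h'.xz,
      h'.zx, h'.zz, h'.yx, h'.yz, map_zero, zero_apply, hl s hs,
      hdlam s hs] at k1 k2
    constructor <;> linarith

/-- The conclusions of the two linear relations between the curvatures of a Bertrand mate. -/
theorem bertrand_relations {S' : Set ℝ} {κ' μ' : ℝ → ℝ} {p q c : ℝ} (hS' : IsOpen S')
    (sκ : ContDiffOn ℝ ∞ κ' S') (sμ : ContDiffOn ℝ ∞ μ' S')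
    (hc : c ≠ 0) (hpq : p ^ 2 + q ^ 2 = 1) (hdκ : ∀ t ∈ S', deriv κ' t ≠ 0)
    (hμ : ∀ t ∈ S', μ' t ≠ 0) {d : ℝ → ℝ} (hd : ∀ t ∈ S', d t ≠ 0)
    (hp : ∀ t ∈ S', p = d t * (1 + c * κ' t)) (hq : ∀ t ∈ S', q = -(d t * (c * μ' t)))
    {t : ℝ} (ht : t ∈ S') :
    p ≠ 0 ∧ q = -(deriv μ' t / deriv κ' t * p) ∧ deriv μ' t ≠ 0 := by
  have hq0 : q ≠ 0 := by
    rw [hq t ht]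
    exact neg_ne_zero.2 (mul_ne_zero (hd t ht) (mul_ne_zero hc (hμ t ht)))
  -- Eliminating the speed `d` leaves constant coefficients, so the relation can be differentiated.
  have hlin (t : ℝ) (ht : t ∈ S') : p * μ' t + q * κ' t = -(q / c) := by
    have e1 := hp t ht
    have e2 := hq t ht
    field_simp
    refine mul_left_cancel₀ (hd t ht) ?_
    linear_combination p * e2 - q * e1
  have hder : p * deriv μ' t + q * deriv κ' t = 0 :=
    hasDerivAt_eq_zero_of_eqOn (((hasDerivAt_of_smoothOn sμ hS' ht).const_mul p).add
      ((hasDerivAt_of_smoothOn sκ hS' ht).const_mul q)) hS' ht hlin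
  have hκ0 := hdκ t ht
  refine ⟨?_, ?_, ?_⟩
  · rintro rfl
    exact mul_ne_zero hq0 hκ0 (by linarith)
  · field_simp
    linarith
  · intro h
    rw [h] at hder
    exact mul_ne_zero hq0 hκ0 (by linarith)

/-- Everything is expressed through the constants `p, q`, which `q = -ρp` and `p² + q² = 1` then
eliminate. The derivative of `B` comes from differentiating `B = ε(pB' - qT')` along `φ`. -/
theorem FrenetSystem.bertrand {g : E →L[ℝ] E →L[ℝ] ℝ} {vol : E [⋀^Fin 3]→ₗ[ℝ] ℝ}
    {S S' : Set ℝ} {T N B T' N' B' a a' : ℝ → E} {κ μ κ' μ' φ lam H ρ : ℝ → ℝ}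
    (h3 : Module.finrank ℝ E = 3) (hS : IsOpen S) (hS' : IsOpen S') (hSc : IsPreconnected S) (hne : S.Nonempty)
    (hF : FrenetSystem g vol S T N B κ μ) (hF' : FrenetSystem g vol S' T' N' B' κ' μ')
    (hφ : ContDiffOn ℝ ∞ φ S) (hbij : BijOn φ S S') (hreg : ∀ s ∈ S, deriv φ s ≠ 0)
    (hnorm : ∀ s ∈ S, ∃ r : ℝ, N s = r • N' (φ s))
    (ha : ∀ s ∈ S, HasDerivAt a (T s) s) (ha' : ∀ t ∈ S', HasDerivAt a' (T' t) t)
    (hmate : ∀ s ∈ S, a' (φ s) = a s + lam s • N s) (hlam : ∃ s ∈ S, lam s ≠ 0)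
    (hκ : ∀ t ∈ S', 0 < κ' t) (hH : ∀ t, H t = μ' t / κ' t)
    (hρ : ∀ t, ρ t = deriv μ' t / deriv κ' t) (hdκ : ∀ t ∈ S', deriv κ' t ≠ 0)
    (hH0 : ∀ t ∈ S', H t ≠ 0) :
    ∃ ε σ : ℝ, (ε = 1 ∨ ε = -1) ∧ (σ = 1 ∨ σ = -1) ∧ ∀ s ∈ S, N s = ε • N' (φ s) ∧
      ρ (φ s) ≠ H (φ s) ∧
      deriv φ s = -σ * (ρ (φ s) - H (φ s)) / (H (φ s) * √(1 + ρ (φ s) ^ 2)) ∧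
      HasDerivAt B ((-(κ' (φ s) * (ρ (φ s) - H (φ s)) ^ 2 /
        (H (φ s) * (1 + ρ (φ s) ^ 2)))) • ε • N' (φ s)) s := by
  have hmap := hbij.mapsTo
  obtain ⟨ε, hε, hN⟩ := exists_sign_of_normals_dependent hSc hF hF' hφ hmap hnorm
  obtain ⟨p, q, hT⟩ := exists_tangent_eq_combination h3 hS hSc hF hF' hφ hmap hε hN
  obtain ⟨c, hc, hpqs⟩ := exists_mate_distance hS hSc hF hF' hφ hmap hε hN hT ha ha' hmate hlam
  have hB (s : ℝ) (hs : s ∈ S) :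
      p ^ 2 + q ^ 2 = 1 ∧ B s = ε • (p • B' (φ s) - q • T' (φ s)) := by
    have h1 := hF.triple s hs
    have h2 := hF.oriented s hs
    rw [hN s hs] at h1 h2
    exact binormal_eq_combination h3 hε h1 (hF'.triple _ (hmap hs)) h2
      (hF'.oriented _ (hmap hs)) (hT s hs)
  obtain ⟨s₀, hs₀⟩ := hne
  have hpq := (hB s₀ hs₀).1
  have hμ0 (t : ℝ) (ht : t ∈ S') : μ' t ≠ 0 := fun h => hH0 t ht (by rw [hH, h, zero_div])
  -- The relations are known along `φ` but must be differentiated in the mate's parameter. A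
  -- set-theoretic inverse suffices, because the speed enters them only as a nonzero factor.
  set ψ := Function.invFunOn φ S
  have hψ (t : ℝ) (ht : t ∈ S') : ψ t ∈ S ∧ φ (ψ t) = t :=
    ⟨Function.invFunOn_mem (hbij.surjOn ht), Function.invFunOn_eq (hbij.surjOn ht)⟩
  have hrel (t : ℝ) (ht : t ∈ S') := bertrand_relations hS' hF'.smooth_κ hF'.smooth_μ hc hpq
    hdκ hμ0 (d := fun t => deriv φ (ψ t)) (fun t ht => hreg _ (hψ t ht).1)
    (fun t ht => by have := (hpqs _ (hψ t ht).1).1; rwa [(hψ t ht).2] at this)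
    (fun t ht => by have := (hpqs _ (hψ t ht).1).2; rwa [(hψ t ht).2] at this) ht
  have hp0 : p ≠ 0 := (hrel _ (hmap hs₀)).1
  have hpσ (t : ℝ) (ht : t ∈ S') : p ^ 2 * (1 + ρ t ^ 2) = 1 := by
    have := (hrel t ht).2.1
    rw [← hρ] at this
    rw [this] at hpq
    linarith
  refine ⟨ε, SignType.sign p, hε, ?_, fun s hs => ?_⟩
  · rcases lt_or_gt_of_ne hp0 with h | h <;> simp [h]
  set t := φ s with ht
  have htS : t ∈ S' := hmap hs
  obtain ⟨e1, e2⟩ := hpqs s hs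
  rw [← ht] at e1 e2
  have hqρ : q = -(ρ t * p) := by rw [hρ]; exact (hrel t htS).2.1
  have hρ0 : ρ t ≠ 0 := by rw [hρ]; exact div_ne_zero (hrel t htS).2.2 (hdκ t htS)
  have hκt := hκ t htS
  have hμH : μ' t = H t * κ' t := by rw [hH]; field_simp
  have hHt := hH0 t htS
  have hφ0 := hreg s hs
  rw [hμH] at e2
  -- Obtained by inserting both curvature formulas into `q = -ρp` and cancelling the speed. If `ρ =
  -- H`, it would force `H = 0`.
  have e3 : c * κ' t * (H t - ρ t) = ρ t := by
    refine mul_left_cancel₀ hφ0 ?_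
    linear_combination ρ t * e1 + e2 - hqρ
  have hne : ρ t ≠ H t := by
    intro h
    rw [h, sub_self, mul_zero] at e3
    exact hHt e3.symm
  have hφp : deriv φ s * H t = -(p * (ρ t - H t)) := by
    linear_combination (ρ t - H t) * e1 - deriv φ s * e3
  have hsq : 0 < √(1 + ρ t ^ 2) := Real.sqrt_pos.2 (by positivity)
  have hsq2 : √(1 + ρ t ^ 2) ^ 2 = 1 + ρ t ^ 2 := Real.sq_sqrt (by positivity)
  have hpsq : p * √(1 + ρ t ^ 2) = SignType.sign p := by
    have h1 : (p * √(1 + ρ t ^ 2)) ^ 2 = 1 := by rw [mul_pow, hsq2, hpσ t htS]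
    rcases lt_or_gt_of_ne hp0 with h | h
    · have := mul_neg_of_neg_of_pos h hsq
      simp only [h, sign_neg, SignType.coe_neg, SignType.coe_one]
      nlinarith
    · have := mul_pos h hsq
      simp only [h, sign_pos, SignType.coe_one]
      nlinarith
  refine ⟨hN s hs, hne, ?_, ?_⟩
  · rw [← hpsq, eq_div_iff (mul_ne_zero hHt hsq.ne')]
    linear_combination √(1 + ρ t ^ 2) * hφp
  · have dφ := hasDerivAt_of_smoothOn hφ hS hs
    have dB : HasDerivAt (fun s => ε • (p • B' (φ s) - q • T' (φ s))) _ s :=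
      ((((hF'.deriv_B t htS).scomp s dφ).const_smul p).sub
        (((hF'.deriv_T t htS).scomp s dφ).const_smul q)).const_smul ε
    refine (dB.congr_of_eventuallyEq
      (Filter.eventually_of_mem (hS.mem_nhds hs) fun u hu => (hB u hu).2)).congr_deriv ?_
    simp only [smul_smul, ← sub_smul]
    congr 1
    have h1 : 1 + ρ t ^ 2 ≠ 0 := by positivity
    -- The derivative is quadratic in `p`, one factor coming from the speed and one from the frame,
    -- so the sign of `p` disappears and `p² = 1/(1 + ρ²)` finishes the computation.
    have h2 := hpσ t htS
    rw [hqρ, hμH]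
    have h3 : deriv φ s = -(p * (ρ t - H t)) / H t := by
      rw [eq_div_iff hHt, hφp]
    rw [h3]
    field_simp
    linear_combination ε * (H t - ρ t) * h2

end Bertrand

/-! ### Change of parameter on an interval -/

section Reparametrization

theorem pos_or_neg_of_isPreconnected {S : Set ℝ} (hS : IsPreconnected S) {f : ℝ → ℝ}
    (hf : ContinuousOn f S) (h0 : ∀ s ∈ S, f s ≠ 0) :
    (∀ s ∈ S, 0 < f s) ∨ ∀ s ∈ S, f s < 0 := by
  have hI := (hS.image f hf).ordConnected
  by_contra! h
  obtain ⟨⟨s, hs, h1⟩, t, ht, h2⟩ := h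
  obtain ⟨u, hu, h3⟩ := hI.out (mem_image_of_mem f hs) (mem_image_of_mem f ht) ⟨h1, h2⟩
  exact h0 u hu h3

theorem hasDerivAt_integral_of_ordConnected {S : Set ℝ} (hS : IsOpen S) (hSc : S.OrdConnected)
    {f : ℝ → ℝ} (hf : ContinuousOn f S) {s₀ s : ℝ} (hs₀ : s₀ ∈ S) (hs : s ∈ S) :
    HasDerivAt (fun u => ∫ v in s₀..u, f v) (f s) s :=
  intervalIntegral.integral_hasDerivAt_right
    (hf.mono (hSc.uIcc_subset hs₀ hs)).intervalIntegrable
    (hf.stronglyMeasurableAtFilter hS s hs) (hf.continuousAt (hS.mem_nhds hs))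

theorem strictMonoOn_of_hasDerivAt_pos {S : Set ℝ} (hSc : S.OrdConnected) {f sb : ℝ → ℝ}
    (hd : ∀ s ∈ S, HasDerivAt sb (f s) s) (hf : ∀ s ∈ S, 0 < f s) : StrictMonoOn sb S :=
  strictMonoOn_of_deriv_pos hSc.convex (fun s hs => (hd s hs).continuousAt.continuousWithinAt)
    fun s hs => by rw [(hd s (interior_subset hs)).deriv]; exact hf s (interior_subset hs)

theorem strictAntiOn_of_hasDerivAt_neg {S : Set ℝ} (hSc : S.OrdConnected) {f sb : ℝ → ℝ}
    (hd : ∀ s ∈ S, HasDerivAt sb (f s) s) (hf : ∀ s ∈ S, f s < 0) : StrictAntiOn sb S :=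
  strictAntiOn_of_deriv_neg hSc.convex (fun s hs => (hd s hs).continuousAt.continuousWithinAt)
    fun s hs => by rw [(hd s (interior_subset hs)).deriv]; exact hf s (interior_subset hs)

/-- A smooth injective function on an open set of reals whose derivative vanishes nowhere has an
open image and a smooth inverse. -/
theorem exists_smooth_inverse {S : Set ℝ} (hS : IsOpen S) {f sb : ℝ → ℝ}
    (hf : ContDiffOn ℝ ∞ f S) (h0 : ∀ s ∈ S, f s ≠ 0) (hd : ∀ s ∈ S, HasDerivAt sb (f s) s)
    (hinj : InjOn sb S) :
    IsOpen (sb '' S) ∧ ∃ ψ : ℝ → ℝ, (∀ s ∈ S, ψ (sb s) = s) ∧ ContDiffOn ℝ ∞ ψ (sb '' S) ∧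
      ∀ s ∈ S, HasDerivAt ψ (f s)⁻¹ (sb s) := by
  have hsm : ContDiffOn ℝ ∞ sb S := (contDiffOn_infty_iff_deriv_of_isOpen hS).2
    ⟨fun s hs => (hd s hs).differentiableAt.differentiableWithinAt,
      hf.congr fun s hs => (hd s hs).deriv⟩
  have hat (s : ℝ) (hs : s ∈ S) : ContDiffAt ℝ ∞ sb s := hsm.contDiffAt (hS.mem_nhds hs)
  have hopen : IsOpen (sb '' S) := by
    rw [isOpen_iff_mem_nhds]
    rintro _ ⟨s, hs, rfl⟩
    rw [← ((hat s hs).hasStrictDerivAt' (hd s hs) (by simp)).map_nhds_eq (h0 s hs)]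
    exact Filter.image_mem_map (hS.mem_nhds hs)
  have hψ (s : ℝ) (hs : s ∈ S) : Function.invFunOn sb S (sb s) = s :=
    hinj.leftInvOn_invFunOn hs
  have hψs (s : ℝ) (hs : s ∈ S) : ContDiffAt ℝ ∞ (Function.invFunOn sb S) (sb s) := by
    have hfd : HasFDerivAt sb
        ((ContinuousLinearEquiv.unitsEquivAut ℝ (Units.mk0 (f s) (h0 s hs)) : ℝ ≃L[ℝ] ℝ) :
          ℝ →L[ℝ] ℝ) s := by
      refine (hd s hs).hasFDerivAt.congr_fderiv ?_
      ext; simp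
    have hn : (∞ : WithTop ℕ∞) ≠ 0 := by simp
    have hL := (hat s hs).to_localInverse hfd hn
    -- By injectivity the global inverse agrees near `sb s` with the local inverse from the inverse
    -- function theorem, and so inherits its smoothness.
    refine hL.congr_of_eventuallyEq ?_
    have hcont := hL.continuousAt.preimage_mem_nhds
      (by rw [(hat s hs).localInverse_apply_image hfd hn]; exact hS.mem_nhds hs)
    have hr := ((hat s hs).hasStrictFDerivAt' hfd hn).eventually_right_inverse
    filter_upwards [hcont, hr] with u h1 h2
    have h3 := hψ _ h1
    have h4 : sb ((hat s hs).localInverse hfd hn u) = u := h2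
    rwa [h4] at h3
  refine ⟨hopen, Function.invFunOn sb S, hψ, ?_, fun s hs => ?_⟩
  · rintro _ ⟨s, hs, rfl⟩
    exact (hψs s hs).contDiffWithinAt
  · refine HasDerivAt.of_local_left_inverse (hψs s hs).continuousAt
      (by rw [hψ s hs]; exact hd s hs) (h0 s hs) ?_
    filter_upwards [hopen.mem_nhds (mem_image_of_mem sb hs)] with u hu
    exact Function.invFunOn_eq hu

end Reparametrization

/-! ### The frame of a curve whose tangent is a principal normal -/

section RotatedFrame

variable {E : Type*} [NormedAddCommGroup E] [NormedSpace ℝ E]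

theorem OrthonormalTriple.rotate {g : E →L[ℝ] E →L[ℝ] ℝ} {x n b : E}
    (t : OrthonormalTriple g x n b) {e h : ℝ} (he : e = 1 ∨ e = -1) :
    OrthonormalTriple g (e • n) ((-e / √(1 + h ^ 2)) • (x - h • b))
      ((1 / √(1 + h ^ 2)) • (h • x + b)) := by
  have hr : (√(1 + h ^ 2)) ^ 2 = 1 + h ^ 2 := Real.sq_sqrt (by positivity)
  have hr0 : √(1 + h ^ 2) ≠ 0 := (Real.sqrt_pos.2 (by positivity)).ne'
  constructor <;>
    simp only [map_smul, map_add, map_sub, smul_apply, add_apply, sub_apply, smul_eq_mul,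
      t.xx, t.yy, t.zz, t.xy, t.yx, t.xz, t.zx, t.yz, t.zy] <;>
    rcases he with rfl | rfl <;> field_simp <;> linarith

/-- Moving `n` to the middle costs a sign, which the determinant `-1` of the remaining coefficients
compensates. -/
theorem alternating_eval_rotate (vol : E [⋀^Fin 3]→ₗ[ℝ] ℝ) (x n b : E) {e : ℝ} (h : ℝ)
    (he : e = 1 ∨ e = -1) :
    vol ![e • n, (-e / √(1 + h ^ 2)) • (x - h • b), (1 / √(1 + h ^ 2)) • (h • x + b)] =
      vol ![x, n, b] := by
  have hr : (√(1 + h ^ 2)) ^ 2 = 1 + h ^ 2 := Real.sq_sqrt (by positivity)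
  have hr0 : √(1 + h ^ 2) ≠ 0 := (Real.sqrt_pos.2 (by positivity)).ne'
  have swap01 (a b c : E) : vol ![a, b, c] = -vol ![b, a, c] := by
    have := vol.map_swap ![b, a, c] (show (0 : Fin 3) ≠ 1 by decide)
    rw [← this]; congr 1; ext i; fin_cases i <;> simp [Equiv.swap_apply_def]
  have h1 : (-e / √(1 + h ^ 2)) • (x - h • b) =
      (-e / √(1 + h ^ 2)) • x + (e / √(1 + h ^ 2) * h) • b := by module
  have h2 : (1 / √(1 + h ^ 2)) • (h • x + b) =
      (1 / √(1 + h ^ 2) * h) • x + (1 / √(1 + h ^ 2)) • b := by module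
  rw [swap01, h1, h2, alternating_eval_combination]
  have : e * (-e / √(1 + h ^ 2) * (1 / √(1 + h ^ 2)) -
      e / √(1 + h ^ 2) * h * (1 / √(1 + h ^ 2) * h)) = -1 := by
    rcases he with rfl | rfl <;> field_simp <;> linarith
  rw [this]; ring

theorem smoothOn_sqrt_one_add_sq {S : Set ℝ} {H : ℝ → ℝ} (hH : ContDiffOn ℝ ∞ H S) :
    ContDiffOn ℝ ∞ (fun t => √(1 + H t ^ 2)) S :=
  (contDiffOn_const.add (hH.pow 2)).sqrt fun t _ => by positivity

/-- The Frenet equations of the reparametrized curve with tangent `ε N`. -/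
theorem FrenetSystem.principalNormal_indicatrix {g : E →L[ℝ] E →L[ℝ] ℝ}
    {vol : E [⋀^Fin 3]→ₗ[ℝ] ℝ} {S J : Set ℝ} {T N B Tb Nb Bb : ℝ → E} {κ μ H θ : ℝ → ℝ} {ε : ℝ}
    (hS : IsOpen S) (hJ : IsOpen J) (hF : FrenetSystem g vol S T N B κ μ)
    (hκ : ∀ t ∈ S, 0 < κ t) (hH : ∀ t, H t = μ t / κ t) (hε : ε = 1 ∨ ε = -1)
    (hθ : ContDiffOn ℝ ∞ θ J) (hmap : MapsTo θ J S)
    (hTb : Tb = fun u => ε • N (θ u))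
    (hNb : Nb = fun u => (-ε / √(1 + H (θ u) ^ 2)) • (T (θ u) - H (θ u) • B (θ u)))
    (hBb : Bb = fun u => (1 / √(1 + H (θ u) ^ 2)) • (H (θ u) • T (θ u) + B (θ u))) :
    ContDiffOn ℝ ∞ Tb J ∧ ContDiffOn ℝ ∞ Nb J ∧ ContDiffOn ℝ ∞ Bb J ∧
      (∀ u ∈ J, OrthonormalTriple g (Tb u) (Nb u) (Bb u)) ∧
      (∀ u ∈ J, 0 < vol ![Tb u, Nb u, Bb u]) ∧
      (∀ u ∈ J, deriv Tb u = (deriv θ u * (κ (θ u) * √(1 + H (θ u) ^ 2))) • Nb u) ∧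
      ∀ u ∈ J, g (deriv Nb u) (Bb u) = deriv θ u * (ε * deriv H (θ u) / (1 + H (θ u) ^ 2)) := by
  have hHs : ContDiffOn ℝ ∞ H S :=
    (hF.smooth_μ.div hF.smooth_κ fun t ht => (hκ t ht).ne').congr fun t _ => hH t
  have hR0 (t : ℝ) : √(1 + H t ^ 2) ≠ 0 := (Real.sqrt_pos.2 (by positivity)).ne'
  have hR2 (t : ℝ) : √(1 + H t ^ 2) ^ 2 = 1 + H t ^ 2 := Real.sq_sqrt (by positivity)
  have hRs (c : ℝ) : ContDiffOn ℝ ∞ (fun t => c / √(1 + H t ^ 2)) S :=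
    contDiffOn_const.div (smoothOn_sqrt_one_add_sq hHs) fun t _ => hR0 t
  have hVs : ContDiffOn ℝ ∞ (fun t => T t - H t • B t) S :=
    hF.smooth_T.sub (hHs.smul hF.smooth_B)
  have hWs : ContDiffOn ℝ ∞ (fun t => H t • T t + B t) S :=
    (hHs.smul hF.smooth_T).add hF.smooth_B
  have dθ (u : ℝ) (hu : u ∈ J) := hasDerivAt_of_smoothOn hθ hJ hu
  subst hTb hNb hBb
  refine ⟨contDiffOn_const.smul (hF.smooth_N.comp hθ hmap),
    ((hRs (-ε)).smul hVs).comp hθ hmap, ((hRs 1).smul hWs).comp hθ hmap,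
    fun u hu => (hF.triple _ (hmap hu)).rotate hε, fun u hu => ?_, fun u hu => ?_,
    fun u hu => ?_⟩
  · rw [alternating_eval_rotate _ _ _ _ _ hε]
    exact hF.oriented _ (hmap hu)
  · have ht := hmap hu
    have d : HasDerivAt (fun u => ε • N (θ u)) _ u :=
      ((hF.deriv_N _ ht).scomp u (dθ u hu)).const_smul ε
    rw [d.deriv]
    have hμ : μ (θ u) = H (θ u) * κ (θ u) := by
      rw [hH, div_mul_cancel₀ _ (hκ _ ht).ne']
    beta_reduce
    rw [hμ, smul_smul (deriv θ u * _), show deriv θ u * (κ (θ u) * √(1 + H (θ u) ^ 2)) *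
      (-ε / √(1 + H (θ u) ^ 2)) = -(deriv θ u * κ (θ u) * ε) by field_simp [hR0 (θ u)]]
    module
  · have ht := hmap hu
    have tr := hF.triple _ ht
    have dV : HasDerivAt (fun t => T t - H t • B t)
        (κ (θ u) • N (θ u) -
          (H (θ u) • (-μ (θ u) • N (θ u)) + deriv H (θ u) • B (θ u))) (θ u) :=
      (hF.deriv_T _ ht).sub ((hasDerivAt_of_smoothOn hHs hS ht).smul (hF.deriv_B _ ht))
    have d : HasDerivAt (fun u => (-ε / √(1 + H (θ u) ^ 2)) • (T (θ u) - H (θ u) • B (θ u))) _ u :=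
      ((hasDerivAt_of_smoothOn (hRs (-ε)) hS ht).smul dV).scomp u (dθ u hu)
    rw [d.deriv]
    -- The derivative of the normalizing factor is never computed: it multiplies `T - HB`, which is
    -- orthogonal to `HT + B`, so it cancels.
    simp only [map_smul, map_add, map_sub, smul_apply, add_apply, sub_apply, smul_eq_mul,
      tr.xx, tr.zz, tr.yx, tr.xz, tr.zx, tr.yz]
    have h0 := hR0 (θ u)
    generalize hw : √(1 + H (θ u) ^ 2) = w at h0 ⊢
    rw [← hR2 (θ u), hw]
    field_simp
    ring

end RotatedFrame

/-! ### From left-invariant frames in the group to Frenet systems -/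

section LieGroups

variable {G : Type*} [TopologicalSpace G] [ChartedSpace V3 G] [Group G]

theorem lieAlg_bracket_self (v : LieAlg G) : ⁅v, v⁆ = 0 := by
  simp [GroupLieAlgebra.bracket_def]

theorem SmoothComp.contDiffOn {S : Set ℝ} {W : ℝ → LieAlg G} (h : SmoothComp S W) :
    ContDiffOn ℝ ∞ (F := V3) W S :=
  contDiffOn_euclidean.2 fun i => h (EuclideanSpace.proj i : V3 →L[ℝ] ℝ)

theorem smoothComp_of_contDiffOn {S : Set ℝ} {W : ℝ → LieAlg G}
    (h : ContDiffOn ℝ ∞ (F := V3) W S) : SmoothComp S W :=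
  fun l => ContinuousLinearMap.contDiff (E := V3) l |>.comp_contDiffOn h

theorem covDeriv_self (T : ℝ → LieAlg G) (s : ℝ) : covDeriv T T s = deriv T s := by
  simp [covDeriv, lieAlg_bracket_self]

variable [LieGroup 𝓘(ℝ, V3) ∞ G]

/-- The scalar product of the metric on `𝔤`, as a bilinear form on the model space. -/
def metricForm (m : Metric3 G) : V3 →L[ℝ] V3 →L[ℝ] ℝ := m.inner (1 : G)

theorem ip_comm (m : Metric3 G) (v w : LieAlg G) : ip m v w = ip m w v :=
  m.symm 1 v w

/-- The modified torsion of a frame is `⟨N', B⟩`. -/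
theorem modTorsion_eq (m : Metric3 G) (T N B : ℝ → LieAlg G) (s : ℝ) :
    modTorsion m T N B (fun s => ip m (covDeriv T N s) (B s)) s = ip m (deriv N s) (B s) := by
  simp [modTorsion, covDeriv, tauG, ip]

theorem IsFrenetFrame.frenetSystem {m : Metric3 G} {vol : LieAlg G [⋀^Fin 3]→ₗ[ℝ] ℝ}
    {S : Set ℝ} {T N B : ℝ → LieAlg G} {κ τ : ℝ → ℝ} (hS : IsOpen S)
    (h : IsFrenetFrame m vol S T N B κ τ) :
    FrenetSystem (E := V3) (metricForm m) vol S T N B κ (modTorsion m T N B τ) := by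
  refine FrenetSystem.mk_of_orthonormal hS finrank_euclideanSpace_fin (ip_comm m)
    h.smooth_T.contDiffOn h.smooth_N.contDiffOn h.smooth_B.contDiffOn (fun s hs => ?_) h.oriented
    (fun s hs => ?_) (fun s hs => ?_)
  · have e1 := h.orth_TN s hs
    have e2 := h.orth_TB s hs
    have e3 := h.orth_NB s hs
    exact ⟨h.unit_T s hs, h.unit_N s hs, h.unit_B s hs, e1, (ip_comm m _ _).trans e1,
      e2, (ip_comm m _ _).trans e2, e3, (ip_comm m _ _).trans e3⟩
  · exact (covDeriv_self T s).symm.trans (h.curvature s hs)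
  · rw [modTorsion, h.torsion s hs]
    exact modTorsion_eq m T N B s

/-- The converse passage, used for the indicatrix. The torsion is taken to be its defining
expression, so that `modTorsion_eq` later reduces the modified torsion to `⟨N', B⟩`. -/
theorem IsFrenetFrame.of_orthonormal {m : Metric3 G} {vol : LieAlg G [⋀^Fin 3]→ₗ[ℝ] ℝ}
    {S : Set ℝ} {T N B : ℝ → LieAlg G} {κ : ℝ → ℝ}
    (hT : ContDiffOn ℝ ∞ (F := V3) T S) (hN : ContDiffOn ℝ ∞ (F := V3) N S)
    (hB : ContDiffOn ℝ ∞ (F := V3) B S)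
    (htr : ∀ s ∈ S, OrthonormalTriple (E := V3) (metricForm m) (T s) (N s) (B s))
    (hor : ∀ s ∈ S, 0 < vol ![T s, N s, B s]) (hκ : ∀ s ∈ S, deriv T s = κ s • N s) :
    IsFrenetFrame m vol S T N B κ (fun s => ip m (covDeriv T N s) (B s)) where
  smooth_T := smoothComp_of_contDiffOn hT
  smooth_N := smoothComp_of_contDiffOn hN
  smooth_B := smoothComp_of_contDiffOn hB
  unit_T s hs := (htr s hs).xx
  unit_N s hs := (htr s hs).yy
  unit_B s hs := (htr s hs).zz
  orth_TN s hs := (htr s hs).xy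
  orth_TB s hs := (htr s hs).xz
  orth_NB s hs := (htr s hs).yz
  oriented := hor
  curvature s hs := (covDeriv_self T s).trans (hκ s hs)
  torsion _ _ := rfl

end LieGroups

/-- The curvature of the binormal indicatrix in closed form. -/
theorem indicatrix_curvature_eq {σ k h r f v : ℝ} (hk : k ≠ 0) (hh : h ≠ 0) (hrh : r ≠ h)
    (hf : f = -(k * (r - h) ^ 2 / (h * (1 + r ^ 2))))
    (hv : v = -σ * (r - h) / (h * √(1 + r ^ 2))) :
    v * f⁻¹ * (k * √(1 + h ^ 2)) = σ * (√((1 + h ^ 2) * (1 + r ^ 2)) / (r - h)) := by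
  have hd : r - h ≠ 0 := sub_ne_zero.2 hrh
  have hq : √(1 + r ^ 2) ≠ 0 := (Real.sqrt_pos.2 (by positivity)).ne'
  have hq2 : √(1 + r ^ 2) ^ 2 = 1 + r ^ 2 := Real.sq_sqrt (by positivity)
  rw [Real.sqrt_mul (by positivity), hf, hv]
  generalize √(1 + r ^ 2) = w at hq hq2 ⊢
  rw [← hq2]
  field_simp

/-- The modified torsion of the binormal indicatrix in closed form. -/
theorem indicatrix_torsion_eq {ε σ k h r f v dk dh : ℝ} (hk : k ≠ 0) (hh : h ≠ 0) (hrh : r ≠ h)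
    (hf : f = -(k * (r - h) ^ 2 / (h * (1 + r ^ 2))))
    (hv : v = -σ * (r - h) / (h * √(1 + r ^ 2))) (hdh : dh = dk * (r - h) / k) :
    v * f⁻¹ * (ε * dh / (1 + h ^ 2)) =
      σ * (ε * dk * √(1 + r ^ 2) / (k ^ 2 * (1 + h ^ 2))) := by
  have hd : r - h ≠ 0 := sub_ne_zero.2 hrh
  have hq : √(1 + r ^ 2) ≠ 0 := (Real.sqrt_pos.2 (by positivity)).ne'
  have hq2 : √(1 + r ^ 2) ^ 2 = 1 + r ^ 2 := Real.sq_sqrt (by positivity)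
  have h1 : 1 + h ^ 2 ≠ 0 := by positivity
  rw [hf, hv, hdh]
  generalize √(1 + r ^ 2) = w at hq hq2 ⊢
  rw [← hq2]
  field_simp

end BertrandLie

theorem theorem3p11
    {G : Type*} [TopologicalSpace G] [ChartedSpace BertrandLie.V3 G] [Group G]
    [LieGroup 𝓘(ℝ, BertrandLie.V3) ∞ G]
    (m : BertrandLie.Metric3 G) (hm : BertrandLie.IsBiInvariant m)
    (vol : BertrandLie.LieAlg G [⋀^Fin 3]→ₗ[ℝ] ℝ) (hvol : vol ≠ 0)
    (S S' : Set ℝ) (hS : IsOpen S) (hS' : IsOpen S') (hSc : S.OrdConnected)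
    (hSc' : S'.OrdConnected)
    (α α' : ℝ → G)
    (T N B : ℝ → BertrandLie.LieAlg G) (κ τ : ℝ → ℝ)
    (T' N' B' : ℝ → BertrandLie.LieAlg G) (κ' τ' : ℝ → ℝ)
    (hα : BertrandLie.IsFrenetApparatus m vol S α T N B κ τ)
    (hα' : BertrandLie.IsFrenetApparatus m vol S' α' T' N' B' κ' τ')
    (φ : ℝ → ℝ) (hpair : BertrandLie.IsBertrandPair S S' T N T' N' φ)
    (H ρ : ℝ → ℝ)
    (hH : H = BertrandLie.harmonicCurvature m T' N' B' κ' τ')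
    (hρ : ρ = BertrandLie.rhoFun m T' N' B' κ' τ')
    (hdκ : ∀ t ∈ S', deriv κ' t ≠ 0) (hH0 : ∀ t ∈ S', H t ≠ 0) :
    ∃ ε σ : ℝ, (ε = 1 ∨ ε = -1) ∧ (σ = 1 ∨ σ = -1) ∧
      (∀ s ∈ S, N s = ε • N' (φ s)) ∧
      (∀ s ∈ S, ρ (φ s) ≠ H (φ s)) ∧
      (∀ s ∈ S, deriv φ s =
        -σ * (ρ (φ s) - H (φ s)) / (H (φ s) * √(1 + ρ (φ s) ^ 2))) ∧
      ∀ s₀ ∈ S, ∀ sb : ℝ → ℝ,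
        (∀ s, sb s = -∫ v in s₀..s, κ' (φ v) * (ρ (φ v) - H (φ v)) ^ 2 /
          (H (φ v) * (1 + ρ (φ v) ^ 2))) →
        (StrictMonoOn sb S ∨ StrictAntiOn sb S) ∧
        ∀ αb : ℝ → BertrandLie.LieAlg G, (∀ s ∈ S, αb (sb s) = B s) →
          ∃ (Tb Nb Bb : ℝ → BertrandLie.LieAlg G) (κb τb : ℝ → ℝ),
            BertrandLie.IsIndicatrixApparatus m vol (sb '' S) αb Tb Nb Bb κb τb ∧
            (∀ s ∈ S,
              Tb (sb s) = ε • N' (φ s) ∧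
              Nb (sb s) = (-ε / √(1 + H (φ s) ^ 2)) • (T' (φ s) - H (φ s) • B' (φ s)) ∧
              Bb (sb s) = (1 / √(1 + H (φ s) ^ 2)) • (H (φ s) • T' (φ s) + B' (φ s)) ∧
              κb (sb s) =
                σ * (√((1 + H (φ s) ^ 2) * (1 + ρ (φ s) ^ 2)) / (ρ (φ s) - H (φ s))) ∧
              BertrandLie.modTorsion m Tb Nb Bb τb (sb s) =
                σ * (ε * deriv κ' (φ s) * √(1 + ρ (φ s) ^ 2) /
                  (κ' (φ s) ^ 2 * (1 + H (φ s) ^ 2)))) ∧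
            ((∀ s ∈ S, 0 < deriv φ s ∧ H (φ s) < 0 ∧ H (φ s) < ρ (φ s)) →
              σ = 1 ∧ StrictMonoOn sb S ∧ ∀ s ∈ S, 0 < κb (sb s)) := by
  rcases S.eq_empty_or_nonempty with rfl | hne
  · refine ⟨1, 1, Or.inl rfl, Or.inl rfl, ?_, ?_, ?_, ?_⟩ <;> simp
  have hF := hα.toIsFrenetFrame.frenetSystem hS
  have hF' := hα'.toIsFrenetFrame.frenetSystem hS'
  obtain ⟨a, a', lam, ha, ha', hmate, hlam⟩ := hpair.mate
  have hφ := hpair.smooth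
  have hmap := hpair.bij.mapsTo
  have hHdef (t : ℝ) : H t = BertrandLie.modTorsion m T' N' B' τ' t / κ' t := by rw [hH]; rfl
  have hρdef (t : ℝ) : ρ t = deriv (BertrandLie.modTorsion m T' N' B' τ') t / deriv κ' t := by
    rw [hρ]; rfl
  clear hH hρ
  set μ' := BertrandLie.modTorsion m T' N' B' τ'
  obtain ⟨ε, σ, hε, hσ, hall⟩ := BertrandLie.FrenetSystem.bertrand (E := BertrandLie.V3)
    finrank_euclideanSpace_fin hS hS' hSc.isPreconnected hne hF hF' hφ hpair.bij hpair.regular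
    hpair.normals ha ha' hmate hlam hα'.curvature_pos hHdef hρdef hdκ hH0
  refine ⟨ε, σ, hε, hσ, fun s hs => (hall s hs).1, fun s hs => (hall s hs).2.1,
    fun s hs => (hall s hs).2.2.1, fun s₀ hs₀ sb hsb => ?_⟩
  have hκ0 (t : ℝ) (ht : t ∈ S') : κ' t ≠ 0 := (hα'.curvature_pos t ht).ne'
  have hHs : ContDiffOn ℝ ∞ H S' := (hF'.smooth_μ.div hF'.smooth_κ hκ0).congr fun t _ => hHdef t
  have hρs : ContDiffOn ℝ ∞ ρ S' :=
    ((BertrandLie.smoothOn_deriv hF'.smooth_μ hS').div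
      (BertrandLie.smoothOn_deriv hF'.smooth_κ hS') hdκ).congr fun t _ => hρdef t
  -- The quotient rule with `μ'` and its derivative replaced by `Hκ'` and `ρ` times the derivative
  -- of `κ'`; this turns the rotation rate of the frame into the stated torsion.
  have hdH (t : ℝ) (ht : t ∈ S') : deriv H t = deriv κ' t * (ρ t - H t) / κ' t := by
    have d := (BertrandLie.hasDerivAt_of_smoothOn hF'.smooth_μ hS' ht).div
      (BertrandLie.hasDerivAt_of_smoothOn hF'.smooth_κ hS' ht) (hκ0 t ht)
    rw [show H = μ' / κ' from funext hHdef, d.deriv, hρdef, Pi.div_apply]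
    have h1 := hκ0 t ht
    have h2 := hdκ t ht
    field_simp
  set f : ℝ → ℝ := fun v => -(κ' (φ v) * (ρ (φ v) - H (φ v)) ^ 2 /
    (H (φ v) * (1 + ρ (φ v) ^ 2))) with hfdef
  have hfs : ContDiffOn ℝ ∞ f S := by
    have hHφ := hHs.comp hφ hmap
    have hρφ := hρs.comp hφ hmap
    refine (((hF'.smooth_κ.comp hφ hmap).mul ((hρφ.sub hHφ).pow 2)).div
      (hHφ.mul (contDiffOn_const.add (hρφ.pow 2))) fun s hs => ?_).neg
    exact mul_ne_zero (hH0 _ (hmap hs)) (by simp only [Function.comp_apply]; positivity)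
  have hf0 (s : ℝ) (hs : s ∈ S) : f s ≠ 0 :=
    neg_ne_zero.2 (div_ne_zero (mul_ne_zero (hκ0 _ (hmap hs))
      (pow_ne_zero 2 (sub_ne_zero.2 (hall s hs).2.1)))
      (mul_ne_zero (hH0 _ (hmap hs)) (by positivity)))
  have hdsb (s : ℝ) (hs : s ∈ S) : HasDerivAt sb (f s) s := by
    rw [show sb = fun s => ∫ v in s₀..s, f v from
      funext fun s => by rw [hsb, hfdef, intervalIntegral.integral_neg]]
    exact BertrandLie.hasDerivAt_integral_of_ordConnected hS hSc hfs.continuousOn hs₀ hs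
  have hmono : StrictMonoOn sb S ∨ StrictAntiOn sb S :=
    (BertrandLie.pos_or_neg_of_isPreconnected hSc.isPreconnected hfs.continuousOn hf0).imp
      (BertrandLie.strictMonoOn_of_hasDerivAt_pos hSc hdsb)
      (BertrandLie.strictAntiOn_of_hasDerivAt_neg hSc hdsb)
  refine ⟨hmono, fun αb hαb => ?_⟩
  obtain ⟨hJ, ψ, hψ, hψs, hdψ⟩ := BertrandLie.exists_smooth_inverse hS hfs hf0 hdsb
    (hmono.elim StrictMonoOn.injOn StrictAntiOn.injOn)
  have hψmap : MapsTo ψ (sb '' S) S := by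
    rintro _ ⟨s, hs, rfl⟩
    rwa [hψ s hs]
  set θ : ℝ → ℝ := fun u => φ (ψ u) with hθdef
  have hθ (s : ℝ) (hs : s ∈ S) : θ (sb s) = φ s := by rw [hθdef]; beta_reduce; rw [hψ s hs]
  have hdθ (s : ℝ) (hs : s ∈ S) : deriv θ (sb s) = deriv φ s * (f s)⁻¹ := by
    have h1 := BertrandLie.hasDerivAt_of_smoothOn hφ hS hs
    -- The chain rule needs the base point in the form `ψ (sb s)`.
    rw [← hψ s hs] at h1
    have h2 := (h1.comp (sb s) (hdψ s hs)).deriv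
    rw [hψ s hs] at h2
    exact h2
  obtain ⟨sT, sN, sB, htr, hor, hdT, hdN⟩ := hF'.principalNormal_indicatrix hS' hJ
    hα'.curvature_pos hHdef hε (hφ.comp hψs hψmap) (hmap.comp hψmap) rfl rfl rfl
  change ∀ u ∈ sb '' S, deriv _ u = (deriv θ u * (κ' (θ u) * √(1 + H (θ u) ^ 2))) • _ at hdT
  have hframe := BertrandLie.IsFrenetFrame.of_orthonormal (G := G) (m := m)
    (κ := fun u => deriv θ u * (κ' (θ u) * √(1 + H (θ u) ^ 2))) sT sN sB htr hor hdT
  have hκb (s : ℝ) (hs : s ∈ S) : deriv θ (sb s) * (κ' (θ (sb s)) * √(1 + H (θ (sb s)) ^ 2)) =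
      σ * (√((1 + H (φ s) ^ 2) * (1 + ρ (φ s) ^ 2)) / (ρ (φ s) - H (φ s))) := by
    rw [hdθ s hs, hθ s hs]
    exact BertrandLie.indicatrix_curvature_eq (hκ0 _ (hmap hs)) (hH0 _ (hmap hs))
      (hall s hs).2.1 rfl (hall s hs).2.2.1
  refine ⟨_, _, _, _, _, ⟨hframe, ?_⟩, fun s hs => ⟨?_, ?_, ?_, hκb s hs, ?_⟩, fun hpos => ?_⟩
  · rintro _ ⟨s, hs, rfl⟩
    change HasDerivAt (F := BertrandLie.V3) αb (ε • N' (θ (sb s))) (sb s)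
    have h1 := (hall s hs).2.2.2
    rw [← hψ s hs] at h1
    have h2 := h1.scomp (sb s) (hdψ s hs)
    rw [hψ s hs] at h2
    -- Unit speed: the derivative of the inverse parameter cancels the scalar in `dB/ds`, since
    -- `s_b` was defined with that scalar as its derivative.
    have h3 : (f s)⁻¹ • f s • ε • (N' (φ s) : BertrandLie.V3) = ε • N' (θ (sb s)) := by
      rw [smul_smul, inv_mul_cancel₀ (hf0 s hs), one_smul, hθ s hs]
    -- `αb` is prescribed only on the image of `sb`, but that set is open, so it determines the
    -- derivative.
    refine (h2.congr_deriv h3).congr_of_eventuallyEq ?_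
    filter_upwards [hJ.mem_nhds (mem_image_of_mem sb hs)]
    rintro _ ⟨t, ht, rfl⟩
    exact (hαb t ht).trans (congrArg B (hψ t ht).symm)
  · show ε • N' (θ (sb s)) = _
    rw [hθ s hs]
  · show (-ε / √(1 + H (θ (sb s)) ^ 2)) • (T' (θ (sb s)) - H (θ (sb s)) • B' (θ (sb s))) = _
    rw [hθ s hs]
  · show (1 / √(1 + H (θ (sb s)) ^ 2)) • (H (θ (sb s)) • T' (θ (sb s)) + B' (θ (sb s))) = _
    rw [hθ s hs]
  · refine (BertrandLie.modTorsion_eq m _ _ _ _).trans ?_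
    refine (hdN (sb s) (mem_image_of_mem sb hs)).trans ?_
    change deriv θ (sb s) * (ε * deriv H (θ (sb s)) / (1 + H (θ (sb s)) ^ 2)) = _
    rw [hdθ s hs, hθ s hs]
    exact BertrandLie.indicatrix_torsion_eq (hκ0 _ (hmap hs)) (hH0 _ (hmap hs))
      (hall s hs).2.1 rfl (hall s hs).2.2.1 (hdH _ (hmap hs))
  · have hσ1 : σ = 1 := by
      obtain ⟨h1, h2, h3⟩ := hpos s₀ hs₀
      refine hσ.resolve_right fun h => h1.not_ge ?_
      rw [(hall s₀ hs₀).2.2.1, h]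
      exact div_nonpos_of_nonneg_of_nonpos (by linarith)
        (mul_nonpos_of_nonpos_of_nonneg h2.le (Real.sqrt_nonneg _))
    refine ⟨hσ1, BertrandLie.strictMonoOn_of_hasDerivAt_pos hSc hdsb fun s hs => ?_,
      fun s hs => ?_⟩
    · obtain ⟨-, h2, h3⟩ := hpos s hs
      refine neg_pos.2 (div_neg_of_pos_of_neg (mul_pos (hα'.curvature_pos _ (hmap hs))
        (pow_pos (sub_pos.2 h3) 2)) (mul_neg_of_neg_of_pos h2 (by positivity)))
    · obtain ⟨-, -, h3⟩ := hpos s hs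
      refine (hκb s hs).symm ▸ ?_
      rw [hσ1, one_mul]
      exact div_pos (Real.sqrt_pos.2 (by positivity)) (sub_pos.2 h3)
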